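/- Let $I\subseteq\mathbb{R}$ be a nonempty open interval and $\mathbb{R}_+$ the set of positive reals. Let $\mathscr{B}_0(I)$ be the class of pairs $(f,g)$ of continuous functions $f,g:I\to\mathbb{R}$ such that $g$ is nowhere zero on $I$ and $f/g$ is strictly monotone on $I$. For $n\ge 1$, let $\mathscr{B}_n(I)$ be the class of pairs $(f,g)$ of $n$ times continuously differentiable functions $f,g:I\to\mathbb{R}$ such that $g$ and $(f/g)'$ are nowhere zero on $I$; then $\mathscr{B}_n(I)\subseteq\mathscr{B}_0(I)$. For $(f,g)\in\mathscr{B}_0(I)$, $x,y\in I$ and $t,s\in\mathbb{R}_+$, let $$B_{f,g}(x,y;t,s):=\Big(\frac fg\Big)^{-1}\Big(\frac{t f(x)+s f(y)}{t g(x)+s g(y)}\Big).$$ For functions $f,g,h,k:I\to\mathbb{R}$ write $(f,g)\sim(h,k)$ if there are real constants $a,b,c,d$ with $ad\neq bc$ such that $h=af+bg$ and $k=cf+dg$ on $I$. For $p\in\mathbb{R}$ define $S_p,C_p:\mathbb{R}\to\mathbb{R}$ by $S_p(x)=\sin(\sqrt{-p}\,x)$, $C_p(x)=\cos(\sqrt{-p}\,x)$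 if $p<0$; $S_0(x)=x$, $C_0(x)=1$; and $S_p(x)=\sinh(\sqrt p\,x)$, $C_p(x)=\cosh(\sqrt p\,x)$ if $p>0$. Consider the invariance equation $$B_{f,g}(x,y;t,s)+B_{h,k}(x,y;s,t)=x+y\qquad(x,y\in I)\tag{1}$$ and the condition $$(f,g)\sim(S_p/\varphi,\,C_p/\varphi)\quad\text{and}\quad(h,k)\sim(S_p\cdot\varphi,\,C_p\cdot\varphi).\tag{2}$$ (Sufficiency) Let $p\in\mathbb{R}$, let $\varphi:I\to\mathbb{R}_+$ be continuous, and let $(f,g),(h,k)\in\mathscr{B}_0(I)$ satisfy (2). Then (1) holds for all $t,s\in\mathbb{R}_+$. (Necessity) Let $(f,g),(h,k)\in\mathscr{B}_4(I)$ and let $t,s\in\mathbb{R}_+$ with $t\neq s$ be such that (1) holds. Then there exist $p\in\mathbb{R}$ and a four times continuously differentiable function $\varphi:I\to\mathbb{R}_+$ such that (2) holds. -/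

import Mathlib

noncomputable section

namespace Bajraktarevic

/-- The weighted two-variable Bajraktarević mean
`B_{f,g}(x,y;t,s) = (f/g)⁻¹ ((t f(x) + s f(y)) / (t g(x) + s g(y)))`,
where `(f/g)⁻¹` is the inverse of the function `f/g` on `I`. -/
def mean (I : Set ℝ) (f g : ℝ → ℝ) (x y t s : ℝ) : ℝ :=
  Function.invFunOn (fun z => f z / g z) I ((t * f x + s * f y) / (t * g x + s * g y))

/-- The regularity classes `𝓑ₙ(I)`. Only the values of `f` and `g` on `I` matter when `I` is open. -/
def regClass (I : Set ℝ) : ℕ → (ℝ → ℝ) → (ℝ → ℝ) → Prop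
  | 0, f, g =>
      ContinuousOn f I ∧ ContinuousOn g I ∧ (∀ x ∈ I, g x ≠ 0) ∧
        (StrictMonoOn (fun x => f x / g x) I ∨ StrictAntiOn (fun x => f x / g x) I)
  | n + 1, f, g =>
      ContDiffOn ℝ ((n + 1 : ℕ) : WithTop ℕ∞) f I ∧ ContDiffOn ℝ ((n + 1 : ℕ) : WithTop ℕ∞) g I ∧
        (∀ x ∈ I, g x ≠ 0) ∧ (∀ x ∈ I, deriv (fun z => f z / g z) x ≠ 0)

/-- Equivalence `(f,g) ∼ (h,k)` of pairs of functions on `I`. -/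
def pairEquiv (I : Set ℝ) (f g h k : ℝ → ℝ) : Prop :=
  ∃ a b c d : ℝ, a * d ≠ b * c ∧
    (∀ x ∈ I, h x = a * f x + b * g x) ∧ (∀ x ∈ I, k x = c * f x + d * g x)

/-- The sine type function `S_p`. -/
def sineType (p x : ℝ) : ℝ :=
  if p < 0 then Real.sin (√(-p) * x) else if p = 0 then x else Real.sinh (√p * x)

/-- The cosine type function `C_p`. -/
def cosineType (p x : ℝ) : ℝ :=
  if p < 0 then Real.cos (√(-p) * x) else if p = 0 then 1 else Real.cosh (√p * x)

/-- The invariance equation `B_{f,g}(x,y;t,s) + B_{h,k}(x,y;s,t) = x + y` for all `x, y ∈ I`. -/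
def invarianceEq (I : Set ℝ) (f g h k : ℝ → ℝ) (t s : ℝ) : Prop :=
  ∀ x ∈ I, ∀ y ∈ I, mean I f g x y t s + mean I h k x y s t = x + y

/-- `(f,g) ∼ (S_p/φ, C_p/φ)` and `(h,k) ∼ (S_p·φ, C_p·φ)`. -/
def solutionForm (I : Set ℝ) (p : ℝ) (φ f g h k : ℝ → ℝ) : Prop :=
  pairEquiv I f g (fun x => sineType p x / φ x) (fun x => cosineType p x / φ x) ∧
    pairEquiv I h k (fun x => sineType p x * φ x) (fun x => cosineType p x * φ x)

end Bajraktarevic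

end

/-!
Write `D(x,u) = f(x) g(u) - f(u) g(x)`. The mean `u = B_{f,g}(x,y;t,s)` is the unique point of `I`
with `t D(x,u) + s D(y,u) = 0` (`mean_spec`, `mean_eq_of_implicit`), and equivalence of pairs only
rescales `D`.

Sufficiency. For `(S_p/φ, C_p/φ)` the equation is `t S_p(x-u)/φ(x) + s S_p(y-u)/φ(y) = 0`. Since
`S_p` is odd, multiplication by `φ(x) φ(y)` turns it into the equation for `(S_p φ, C_p φ)` with
weights `s, t` at the reflected point `x + y - u`.

Necessity. Dividing by the square root `φ₁` of the absolute value of the Wronskian writes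
`f = ± φ₁ z`, `g = φ₁ w`, where `z, w` solve `y'' = P y` and have Wronskian `1`
(`exists_isSolutionPair`); likewise `(h,k)` gives `φ₂` and `Q`. Let `D₁, D₂` be the
corresponding fundamental solutions and `v = x + y - u`. The two implicit equations multiply to
`φ₁φ₂(x) D₁(x,u) D₂(x,v) = φ₁φ₂(y) D₁(y,u) D₂(y,v)`, from which `t` and `s` have disappeared.
By `fundSol_expansion`, `D(x,u) = e + q(m) e³/6 + o(h) e³`, where `q` is `P` or `Q`, `e = x - u`,
`m` is the midpoint of `x` and `u`, and `h = y - x`. With `a = y - u` and `b = u - x`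
one has `a/h → t/(t+s)` and `b/h → s/(t+s)`, and comparison of orders as `y ↓ x` gives:

* order one: the right derivative of `φ₁φ₂` is zero, so `φ₁φ₂` is constant;
* order two: `(a² - b²)(P - Q) = o(h²)`, so `P = Q` because `t ≠ s`;
* order three: `a b (a + b) P' = o(h³)`, so `P' = 0`.

Hence `P = Q = p` is constant, the solution pairs are linear combinations of `S_p, C_p`
(`IsSolutionPair.exists_sineType_eq`), and `φ = 1/φ₁` is as required.
-/

open Filter Topology

namespace Bajraktarevic

/-! ### Means and their implicit equation -/

/-- A nowhere vanishing continuous function on an interval has constant sign. -/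
lemma mul_pos_of_continuousOn_ne_zero {I : Set ℝ} (hI : I.OrdConnected) {g : ℝ → ℝ}
    (hg : ContinuousOn g I) (h0 : ∀ x ∈ I, g x ≠ 0) {x y : ℝ} (hx : x ∈ I) (hy : y ∈ I) :
    0 < g x * g y := by
  by_contra hneg
  have hpre : IsPreconnected (g '' I) := hI.isPreconnected.image g hg
  have hmem : (0 : ℝ) ∈ g '' I := by
    have hoc := hpre.ordConnected
    rcases lt_or_gt_of_ne (h0 x hx) with h1 | h1 <;> rcases lt_or_gt_of_ne (h0 y hy) with h2 | h2
    · exact absurd (mul_pos_of_neg_of_neg h1 h2) hneg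
    · exact hoc.out ⟨x, hx, rfl⟩ ⟨y, hy, rfl⟩ ⟨h1.le, h2.le⟩
    · exact hoc.out ⟨y, hy, rfl⟩ ⟨x, hx, rfl⟩ ⟨h2.le, h1.le⟩
    · exact absurd (mul_pos h1 h2) hneg
  obtain ⟨z, hz, hz0⟩ := hmem
  exact h0 z hz hz0

lemma regClass_zero_injOn {I : Set ℝ} {f g : ℝ → ℝ} (h : regClass I 0 f g) :
    Set.InjOn (fun x => f x / g x) I := by
  rcases h.2.2.2 with h | h
  · exact h.injOn
  · exact h.injOn

/-- The denominator in the definition of the mean does not vanish. -/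
lemma weighted_denom_ne_zero {I : Set ℝ} (hI : I.OrdConnected) {f g : ℝ → ℝ}
    (h : regClass I 0 f g) {x y t s : ℝ} (hx : x ∈ I) (hy : y ∈ I) (ht : 0 < t) (hs : 0 < s) :
    t * g x + s * g y ≠ 0 := by
  intro h0
  have h1 := mul_pos_of_continuousOn_ne_zero hI h.2.1 h.2.2.1 hx hy
  have h2 : t * (g x * g x) + s * (g x * g y) = 0 := by linear_combination g x * h0
  have h3 : 0 ≤ g x * g x := mul_self_nonneg _
  have := mul_pos hs h1
  have := mul_nonneg ht.le h3
  linarith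

/-- A point of `I` solving the implicit equation is the mean. -/
lemma mean_eq_of_implicit {I : Set ℝ} (hI : I.OrdConnected) {f g : ℝ → ℝ}
    (h : regClass I 0 f g) {x y t s w : ℝ} (hx : x ∈ I) (hy : y ∈ I) (ht : 0 < t) (hs : 0 < s)
    (hw : w ∈ I)
    (heq : t * (f x * g w - f w * g x) + s * (f y * g w - f w * g y) = 0) :
    mean I f g x y t s = w := by
  have hd := weighted_denom_ne_zero hI h hx hy ht hs
  have hgw := h.2.2.1 w hw
  have hval : (t * f x + s * f y) / (t * g x + s * g y) = (fun z => f z / g z) w := by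
    simp only
    rw [div_eq_div_iff hd hgw]
    linear_combination heq
  unfold mean
  rw [hval]
  exact (regClass_zero_injOn h).leftInvOn_invFunOn hw

/-- The mean lies between its arguments and solves the implicit equation. -/
lemma mean_spec {I : Set ℝ} (hI : I.OrdConnected) {f g : ℝ → ℝ}
    (h : regClass I 0 f g) {x y t s : ℝ} (hx : x ∈ I) (hy : y ∈ I) (ht : 0 < t) (hs : 0 < s) :
    ∃ u ∈ Set.uIcc x y, mean I f g x y t s = u ∧
      t * (f x * g u - f u * g x) + s * (f y * g u - f u * g y) = 0 := by
  have hd := weighted_denom_ne_zero hI h hx hy ht hs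
  have hsub : Set.uIcc x y ⊆ I := hI.uIcc_subset hx hy
  have hcont : ContinuousOn (fun z => f z / g z) (Set.uIcc x y) :=
    (h.1.div h.2.1 h.2.2.1).mono hsub
  have hgx := h.2.2.1 x hx
  have hgy := h.2.2.1 y hy
  have hmem : (t * f x + s * f y) / (t * g x + s * g y) ∈ Set.uIcc (f x / g x) (f y / g y) := by
    rw [← segment_eq_uIcc]
    -- the quotient is a convex combination of the end values with weights `t g(x)` and `s g(y)`
    have hp := mul_pos_of_continuousOn_ne_zero hI h.2.1 h.2.2.1 hx hy
    have hx2 : 0 < g x * g x := mul_self_pos.2 hgx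
    have hD : 0 < t * (g x * g x) + s * (g x * g y) := by positivity
    refine ⟨t * (g x * g x) / (t * (g x * g x) + s * (g x * g y)),
      s * (g x * g y) / (t * (g x * g x) + s * (g x * g y)), by positivity, by positivity, ?_, ?_⟩
    · rw [← add_div, div_self hD.ne']
    · have : t * (g x * g x) + s * (g x * g y) = g x * (t * g x + s * g y) := by ring
      rw [this]
      simp only [smul_eq_mul]
      field_simp
  obtain ⟨u, hu, huv⟩ := intermediate_value_uIcc hcont hmem
  have heq : t * (f x * g u - f u * g x) + s * (f y * g u - f u * g y) = 0 := by
    have hgu := h.2.2.1 u (hsub hu)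
    simp only at huv
    rw [div_eq_div_iff hgu hd] at huv
    linear_combination -huv
  exact ⟨u, hu, mean_eq_of_implicit hI h hx hy ht hs (hsub hu) heq, heq⟩

/-- For distinct arguments the mean is strict. -/
lemma mean_spec_strict {I : Set ℝ} (hI : I.OrdConnected) {f g : ℝ → ℝ}
    (h : regClass I 0 f g) {x y t s : ℝ} (hx : x ∈ I) (hy : y ∈ I) (hxy : x < y)
    (ht : 0 < t) (hs : 0 < s) :
    ∃ u ∈ Set.Ioo x y, mean I f g x y t s = u ∧
      t * (f x * g u - f u * g x) + s * (f y * g u - f u * g y) = 0 := by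
  obtain ⟨u, hu, hm, heq⟩ := mean_spec hI h hx hy ht hs
  rw [Set.uIcc_of_le hxy.le] at hu
  have hne : f x * g y - f y * g x ≠ 0 := by
    intro h0
    refine hxy.ne (regClass_zero_injOn h hx hy ?_)
    simp only
    rw [div_eq_div_iff (h.2.2.1 x hx) (h.2.2.1 y hy)]
    linarith
  refine ⟨u, ⟨lt_of_le_of_ne hu.1 ?_, lt_of_le_of_ne hu.2 ?_⟩, hm, heq⟩
  · rintro rfl
    have : s * (f x * g y - f y * g x) = 0 := by linear_combination -heq
    exact (mul_ne_zero hs.ne' hne) this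
  · rintro rfl
    have : t * (f x * g u - f u * g x) = 0 := by linear_combination heq
    exact (mul_ne_zero ht.ne' hne) this

/-- Equivalent pairs have proportional determinants `f(x) g(u) - f(u) g(x)`. -/
lemma pairEquiv.exists_det_eq {I : Set ℝ} {f g h k : ℝ → ℝ} (H : pairEquiv I f g h k) :
    ∃ c : ℝ, c ≠ 0 ∧ ∀ x ∈ I, ∀ u ∈ I,
      h x * k u - h u * k x = c * (f x * g u - f u * g x) := by
  obtain ⟨a, b, c, d, hdet, h1, h2⟩ := H
  refine ⟨a * d - b * c, sub_ne_zero.2 hdet, fun x hx u hu => ?_⟩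
  rw [h1 x hx, h1 u hu, h2 x hx, h2 u hu]
  ring

/-! ### Sine and cosine type functions -/

lemma sineType_sub (p x y : ℝ) :
    sineType p (x - y) = sineType p x * cosineType p y - sineType p y * cosineType p x := by
  unfold sineType cosineType
  split_ifs
  · rw [mul_sub, Real.sin_sub]; ring
  · ring
  · rw [mul_sub, Real.sinh_sub]; ring

lemma sineType_neg (p x : ℝ) : sineType p (-x) = -sineType p x := by
  unfold sineType
  split_ifs <;> simp

/-- The factors `ω` and `κ` in `S_p' = ω C_p`, `C_p' = κ S_p`. Their product is `p`, and since
`S_p` is not normalized to have derivative `1` at the origin, `ω` is `√|p|` unless `p = 0`. -/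
lemma exists_sineType_hasDerivAt (p : ℝ) : ∃ ω κ : ℝ, ω ≠ 0 ∧ ω * κ = p ∧
    (∀ x, HasDerivAt (sineType p) (ω * cosineType p x) x) ∧
    (∀ x, HasDerivAt (cosineType p) (κ * sineType p x) x) ∧
    (∀ x, ω * cosineType p x ^ 2 - κ * sineType p x ^ 2 = ω) := by
  rcases lt_trichotomy p 0 with hp | rfl | hp
  · have hS : sineType p = fun x => Real.sin (√(-p) * x) := by
      funext x; simp [sineType, hp]
    have hC : cosineType p = fun x => Real.cos (√(-p) * x) := by
      funext x; simp [cosineType, hp]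
    rw [hS, hC]
    have hsq := Real.mul_self_sqrt (show 0 ≤ -p by linarith)
    refine ⟨√(-p), -√(-p), (Real.sqrt_pos.2 (by linarith)).ne', by linarith, fun x => ?_,
      fun x => ?_, fun x => ?_⟩
    · have := ((hasDerivAt_id' x).const_mul √(-p)).sin
      convert this using 1
      ring
    · have := ((hasDerivAt_id' x).const_mul √(-p)).cos
      convert this using 1
      ring
    · have := Real.sin_sq_add_cos_sq (√(-p) * x)
      linear_combination √(-p) * this
  · have hS : sineType 0 = fun x => x := by
      funext x; simp [sineType]
    have hC : cosineType 0 = fun _ => 1 := by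
      funext x; simp [cosineType]
    rw [hS, hC]
    refine ⟨1, 0, one_ne_zero, by simp, fun x => ?_, fun x => ?_, fun x => by simp⟩
    · exact (hasDerivAt_id' x).congr_deriv (by norm_num)
    · simpa using hasDerivAt_const x (1 : ℝ)
  · have hS : sineType p = fun x => Real.sinh (√p * x) := by
      funext x; simp [sineType, hp.not_gt, hp.ne']
    have hC : cosineType p = fun x => Real.cosh (√p * x) := by
      funext x; simp [cosineType, hp.not_gt, hp.ne']
    rw [hS, hC]
    refine ⟨√p, √p, (Real.sqrt_pos.2 hp).ne', Real.mul_self_sqrt hp.le, fun x => ?_,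
      fun x => ?_, fun x => ?_⟩
    · have := ((hasDerivAt_id' x).const_mul √p).sinh
      convert this using 1
      ring
    · have := ((hasDerivAt_id' x).const_mul √p).cosh
      convert this using 1
      ring
    · have := Real.cosh_sq (√p * x)
      linear_combination √p * this

lemma contDiff_sineType (p : ℝ) {n : WithTop ℕ∞} : ContDiff ℝ n (sineType p) := by
  unfold sineType
  split_ifs
  · exact Real.contDiff_sin.comp (contDiff_const.mul contDiff_id)
  · exact contDiff_id
  · exact Real.contDiff_sinh.comp (contDiff_const.mul contDiff_id)

lemma contDiff_cosineType (p : ℝ) {n : WithTop ℕ∞} : ContDiff ℝ n (cosineType p) := by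
  unfold cosineType
  split_ifs
  · exact Real.contDiff_cos.comp (contDiff_const.mul contDiff_id)
  · exact contDiff_const
  · exact Real.contDiff_cosh.comp (contDiff_const.mul contDiff_id)

/-! ### Sufficiency -/

/-- The implicit equations of the two means are interchanged by the reflection
`u ↦ x + y - u`, because `S_p` is odd and satisfies the subtraction formula. -/
lemma invarianceEq_of_solutionForm {I : Set ℝ} (hI : I.OrdConnected) {p : ℝ}
    {φ f g h k : ℝ → ℝ} (hφ : ∀ x ∈ I, 0 < φ x) (hfg : regClass I 0 f g)
    (hhk : regClass I 0 h k) (hsol : solutionForm I p φ f g h k) {t s : ℝ} (ht : 0 < t)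
    (hs : 0 < s) : invarianceEq I f g h k t s := by
  intro x hx y hy
  obtain ⟨u, hu, hm, heq⟩ := mean_spec hI hfg hx hy ht hs
  have hsub := hI.uIcc_subset hx hy
  have huI := hsub hu
  have hv : x + y - u ∈ Set.uIcc x y := by
    rw [Set.mem_uIcc] at hu ⊢
    rcases hu with hu | hu
    · left; constructor <;> linarith [hu.1, hu.2]
    · right; constructor <;> linarith [hu.1, hu.2]
  have hvI := hsub hv
  obtain ⟨c, hc, hcd⟩ := hsol.1.exists_det_eq
  obtain ⟨d, hd, hdd⟩ := hsol.2.exists_det_eq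
  have hx0 := hφ x hx
  have hy0 := hφ y hy
  have hu0 := hφ u huI
  have key : t * sineType p (x - u) * φ y + s * sineType p (y - u) * φ x = 0 := by
    have h1 := hcd x hx u huI
    have h2 := hcd y hy u huI
    rw [sineType_sub, sineType_sub]
    field_simp at h1 h2
    linear_combination t * φ y * h1 + s * φ x * h2 + c * φ u * φ x * φ y * heq
  rw [hm, mean_eq_of_implicit hI hhk hx hy hs ht hvI]
  · ring
  · have h1 := hdd x hx _ hvI
    have h2 := hdd y hy _ hvI
    have e1 : sineType p (x - (x + y - u)) = -sineType p (y - u) := by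
      rw [← sineType_neg]; congr 1; ring
    have e2 : sineType p (y - (x + y - u)) = -sineType p (x - u) := by
      rw [← sineType_neg]; congr 1; ring
    rw [sineType_sub] at e1 e2
    refine (mul_eq_zero.1 (?_ : d * _ = 0)).resolve_left hd
    linear_combination -s * h1 - t * h2 + s * φ x * φ (x + y - u) * e1
      + t * φ y * φ (x + y - u) * e2 - φ (x + y - u) * key

/-! ### Reduction to the equation `z'' = q z` -/

/-- `z` and `w` are solutions on `I` of `y'' = q y` with derivatives `z'`, `w'` and with constant
Wronskian `1`. -/
structure IsSolutionPair (I : Set ℝ) (q z w z' w' : ℝ → ℝ) : Prop where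
  deriv_fst : ∀ x ∈ I, HasDerivAt z (z' x) x
  deriv_snd : ∀ x ∈ I, HasDerivAt w (w' x) x
  deriv_deriv_fst : ∀ x ∈ I, HasDerivAt z' (q x * z x) x
  deriv_deriv_snd : ∀ x ∈ I, HasDerivAt w' (q x * w x) x
  wronskian : ∀ x ∈ I, z' x * w x - z x * w' x = 1

/-- Dividing by the square root of the Wronskian turns a `C⁴` pair into a solution pair of
`y'' = q y` in which `q` is still differentiable. -/
lemma exists_isSolutionPair_of_wronskian_pos {I : Set ℝ} (hI : IsOpen I) {f g : ℝ → ℝ}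
    (hf : ContDiffOn ℝ 4 f I) (hg : ContDiffOn ℝ 4 g I)
    (hW : ∀ x ∈ I, 0 < deriv f x * g x - f x * deriv g x) :
    ∃ φ z w z' w' q q' : ℝ → ℝ, (∀ x ∈ I, 0 < φ x) ∧ ContinuousOn φ I ∧
      (∀ x ∈ I, f x = φ x * z x) ∧ (∀ x ∈ I, g x = φ x * w x) ∧
      IsSolutionPair I q z w z' w' ∧ (∀ x ∈ I, HasDerivAt q (q' x) x) := by
  set W : ℝ → ℝ := fun x => deriv f x * g x - f x * deriv g x with hWdef
  have hf' : ContDiffOn ℝ 3 (deriv f) I := hf.deriv_of_isOpen hI (by norm_num)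
  have hg' : ContDiffOn ℝ 3 (deriv g) I := hg.deriv_of_isOpen hI (by norm_num)
  have hf3 : ContDiffOn ℝ 3 f I := hf.of_le (by norm_num)
  have hg3 : ContDiffOn ℝ 3 g I := hg.of_le (by norm_num)
  have hWc : ContDiffOn ℝ 3 W I := (hf'.mul hg3).sub (hf3.mul hg')
  have hφc : ContDiffOn ℝ 3 (fun x => √(W x)) I := hWc.sqrt fun x hx => (hW x hx).ne'
  have hφpos : ∀ x ∈ I, 0 < √(W x) := fun x hx => Real.sqrt_pos.2 (hW x hx)
  set z : ℝ → ℝ := fun x => f x / √(W x) with hz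
  set w : ℝ → ℝ := fun x => g x / √(W x) with hw
  have hzc : ContDiffOn ℝ 3 z I := hf3.div hφc fun x hx => (hφpos x hx).ne'
  have hwc : ContDiffOn ℝ 3 w I := hg3.div hφc fun x hx => (hφpos x hx).ne'
  have hz1 : ContDiffOn ℝ 2 (deriv z) I := hzc.deriv_of_isOpen hI (by norm_num)
  have hw1 : ContDiffOn ℝ 2 (deriv w) I := hwc.deriv_of_isOpen hI (by norm_num)
  have hz2 : ContDiffOn ℝ 1 (deriv (deriv z)) I := hz1.deriv_of_isOpen hI (by norm_num)
  have hw2 : ContDiffOn ℝ 1 (deriv (deriv w)) I := hw1.deriv_of_isOpen hI (by norm_num)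
  have hD : ∀ {n : WithTop ℕ∞} {F : ℝ → ℝ}, n ≠ 0 → ContDiffOn ℝ n F I → ∀ x ∈ I,
      HasDerivAt F (deriv F x) x := fun hn hF x hx =>
    ((hF.differentiableOn hn).differentiableAt (hI.mem_nhds hx)).hasDerivAt
  have hwr : ∀ x ∈ I, deriv z x * w x - z x * deriv w x = 1 := by
    intro x hx
    have hφx := hφpos x hx
    have dφ := hD (by norm_num) hφc x hx
    have dz := ((hD (by norm_num) hf x hx).div dφ hφx.ne').deriv
    have dw := ((hD (by norm_num) hg x hx).div dφ hφx.ne').deriv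
    change deriv z x = _ at dz
    change deriv w x = _ at dw
    have hsq : √(W x) ^ 2 = deriv f x * g x - f x * deriv g x := Real.sq_sqrt (hW x hx).le
    rw [dz, dw]
    simp only [hz, hw]
    field_simp
    linear_combination -√(W x) * hsq
  have hwr' : ∀ x ∈ I, deriv (deriv z) x * w x - z x * deriv (deriv w) x = 0 := by
    intro x hx
    have h1 := ((hD (by norm_num) hz1 x hx).mul (hD (by norm_num) hwc x hx)).sub
      ((hD (by norm_num) hzc x hx).mul (hD (by norm_num) hw1 x hx))
    have h2 : HasDerivAt (deriv z * w - z * deriv w) 0 x :=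
      (hasDerivAt_const x (1 : ℝ)).congr_of_eventuallyEq
        (Filter.eventually_of_mem (hI.mem_nhds hx) fun y hy => hwr y hy)
    have h3 := h1.unique h2
    linear_combination h3
  set q : ℝ → ℝ := fun x => deriv z x * deriv (deriv w) x - deriv (deriv z) x * deriv w x with hq
  have hqc : ContDiffOn ℝ 1 q I :=
    ((hz1.of_le (by norm_num)).mul hw2).sub (hz2.mul (hw1.of_le (by norm_num)))
  refine ⟨fun x => √(W x), z, w, deriv z, deriv w, q, deriv q, hφpos, hφc.continuousOn,
    fun x hx => ?_, fun x hx => ?_, ⟨hD (by norm_num) hzc, hD (by norm_num) hwc,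
    fun x hx => ?_, fun x hx => ?_, hwr⟩, hD (by norm_num) hqc⟩
  · have := (hφpos x hx).ne'
    simp only [hz]; field_simp
  · have := (hφpos x hx).ne'
    simp only [hw]; field_simp
  · refine (hD (by norm_num) hz1 x hx).congr_deriv ?_
    simp only [hq]
    linear_combination -deriv (deriv z) x * hwr x hx + deriv z x * hwr' x hx
  · refine (hD (by norm_num) hw1 x hx).congr_deriv ?_
    simp only [hq]
    linear_combination -deriv (deriv w) x * hwr x hx + deriv w x * hwr' x hx

lemma regClass_hasDerivAt_div {I : Set ℝ} (hI : IsOpen I) {f g : ℝ → ℝ}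
    (h : regClass I 4 f g) {x : ℝ} (hx : x ∈ I) :
    HasDerivAt (fun z => f z / g z) ((deriv f x * g x - f x * deriv g x) / g x ^ 2) x := by
  obtain ⟨hf, hg, h0, -⟩ := h
  exact ((hf.differentiableOn (by norm_num)).differentiableAt (hI.mem_nhds hx)).hasDerivAt.div
    ((hg.differentiableOn (by norm_num)).differentiableAt (hI.mem_nhds hx)).hasDerivAt (h0 x hx)

/-- By Darboux's theorem the derivative of the quotient has constant sign. -/
lemma regClass_wronskian_sign {I : Set ℝ} (hI : IsOpen I) (hI' : I.OrdConnected)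
    {f g : ℝ → ℝ} (h : regClass I 4 f g) :
    (∀ x ∈ I, deriv f x * g x - f x * deriv g x < 0) ∨
      (∀ x ∈ I, 0 < deriv f x * g x - f x * deriv g x) := by
  have hd := fun x (hx : x ∈ I) => regClass_hasDerivAt_div hI h hx
  have hg2 : ∀ x ∈ I, 0 < g x ^ 2 := fun x hx => by
    have := h.2.2.1 x hx
    positivity
  rcases hasDerivWithinAt_forall_lt_or_forall_gt_of_forall_ne hI'.convex
    (fun x hx => (hd x hx).hasDerivWithinAt) (m := 0)
    (fun x hx => by rw [← (hd x hx).deriv]; exact h.2.2.2 x hx) with H | H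
  · left
    intro x hx
    have := H x hx
    rw [div_lt_iff₀ (hg2 x hx)] at this
    linarith
  · right
    intro x hx
    have := H x hx
    rw [lt_div_iff₀ (hg2 x hx)] at this
    linarith

lemma regClass_four_subset_zero {I : Set ℝ} (hI : IsOpen I) (hI' : I.OrdConnected)
    {f g : ℝ → ℝ} (h : regClass I 4 f g) : regClass I 0 f g := by
  have hd := fun x (hx : x ∈ I) => regClass_hasDerivAt_div hI h hx
  have hg2 : ∀ x ∈ I, 0 < g x ^ 2 := fun x hx => by
    have := h.2.2.1 x hx
    positivity
  have hc : ContinuousOn (fun z => f z / g z) I := fun x hx =>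
    (hd x hx).continuousAt.continuousWithinAt
  refine ⟨h.1.continuousOn, h.2.1.continuousOn, h.2.2.1, ?_⟩
  rcases regClass_wronskian_sign hI hI' h with H | H
  · right
    refine strictAntiOn_of_deriv_neg hI'.convex hc fun x hx => ?_
    rw [hI.interior_eq] at hx
    rw [(hd x hx).deriv]
    exact div_neg_of_neg_of_pos (H x hx) (hg2 x hx)
  · left
    refine strictMonoOn_of_deriv_pos hI'.convex hc fun x hx => ?_
    rw [hI.interior_eq] at hx
    rw [(hd x hx).deriv]
    exact div_pos (H x hx) (hg2 x hx)

/-- Normal form of a pair in `𝓑₄(I)`; the sign `σ` is that of the Wronskian. -/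
lemma exists_isSolutionPair {I : Set ℝ} (hI : IsOpen I) (hI' : I.OrdConnected) {f g : ℝ → ℝ}
    (h : regClass I 4 f g) :
    ∃ (σ : ℝ) (φ z w z' w' q q' : ℝ → ℝ), σ ≠ 0 ∧ (∀ x ∈ I, 0 < φ x) ∧ ContinuousOn φ I ∧
      (∀ x ∈ I, f x = σ * (φ x * z x)) ∧ (∀ x ∈ I, g x = φ x * w x) ∧
      IsSolutionPair I q z w z' w' ∧ (∀ x ∈ I, HasDerivAt q (q' x) x) := by
  rcases regClass_wronskian_sign hI hI' h with H | H
  · have hneg : ∀ x ∈ I, 0 < deriv (-f) x * g x - (-f) x * deriv g x := by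
      intro x hx
      have := H x hx
      rw [deriv.neg, Pi.neg_apply]
      linarith
    obtain ⟨φ, z, w, z', w', q, q', h1, h2, h3, h4⟩ :=
      exists_isSolutionPair_of_wronskian_pos hI h.1.neg h.2.1 hneg
    refine ⟨-1, φ, z, w, z', w', q, q', by norm_num, h1, h2, fun x hx => ?_, h4⟩
    have : -f x = φ x * z x := h3 x hx
    linarith
  · obtain ⟨φ, z, w, z', w', q, q', h1, h2, h3, h4⟩ :=
      exists_isSolutionPair_of_wronskian_pos hI h.1 h.2.1 H
    exact ⟨1, φ, z, w, z', w', q, q', one_ne_zero, h1, h2,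
      fun x hx => by rw [one_mul]; exact h3 x hx, h4⟩

/-! ### Expansion of the fundamental solution at the diagonal -/

/-- For a solution pair, the solution of `y'' = q y` with `y(u) = 0`, `y'(u) = 1`, at the
point `x`. -/
def fundSol (z w : ℝ → ℝ) (x u : ℝ) : ℝ := z x * w u - z u * w x

/-- Taylor's bound with a vanishing one-jet at `u`, with an unoptimized constant. -/
lemma abs_le_of_second_deriv_le {s : Set ℝ} (hs : Convex ℝ s) {r r' r'' : ℝ → ℝ} {u K : ℝ}
    (hu : u ∈ s) (h1 : ∀ x ∈ s, HasDerivAt r (r' x) x) (h2 : ∀ x ∈ s, HasDerivAt r' (r'' x) x)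
    (hr : r u = 0) (hr' : r' u = 0) (hK : ∀ x ∈ s, |r'' x| ≤ K * |x - u|) :
    ∀ x ∈ s, |r x| ≤ K * |x - u| ^ 3 := by
  intro x hx
  have hsub : ∀ y ∈ s, segment ℝ u y ⊆ s := fun y hy => hs.segment_subset hu hy
  have hle : ∀ y, ∀ a ∈ segment ℝ u y, |a - u| ≤ |y - u| := by
    intro y a ha
    rw [segment_eq_uIcc] at ha
    exact Set.abs_sub_left_of_mem_uIcc ha
  rcases eq_or_ne x u with rfl | hne
  · simp [hr]
  have hK0 : 0 ≤ K := by
    have := (abs_nonneg _).trans (hK x hx)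
    exact nonneg_of_mul_nonneg_left this (abs_pos.2 (sub_ne_zero.2 hne))
  have hb1 : ∀ y ∈ s, |r' y| ≤ K * |y - u| ^ 2 := by
    intro y hy
    have := (convex_segment u y).norm_image_sub_le_of_norm_hasDerivWithin_le
      (f := r') (f' := r'') (C := K * |y - u|)
      (fun a ha => (h2 a (hsub y hy ha)).hasDerivWithinAt)
      (fun a ha => (hK a (hsub y hy ha)).trans
        (mul_le_mul_of_nonneg_left (hle y a ha) hK0))
      (left_mem_segment ℝ u y) (right_mem_segment ℝ u y)
    rw [hr', sub_zero, Real.norm_eq_abs, Real.norm_eq_abs] at this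
    linarith
  have := (convex_segment u x).norm_image_sub_le_of_norm_hasDerivWithin_le
    (f := r) (f' := r') (C := K * |x - u| ^ 2)
    (fun a ha => (h1 a (hsub x hx ha)).hasDerivWithinAt)
    (fun a ha => (hb1 a (hsub x hx ha)).trans
      (mul_le_mul_of_nonneg_left (pow_le_pow_left₀ (abs_nonneg _) (hle x a ha) 2) hK0))
    (left_mem_segment ℝ u x) (right_mem_segment ℝ u x)
  rw [hr, sub_zero, Real.norm_eq_abs, Real.norm_eq_abs] at this
  linarith

namespace IsSolutionPair

variable {I : Set ℝ} {q z w z' w' : ℝ → ℝ}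

lemma hasDerivAt_fundSol (h : IsSolutionPair I q z w z' w') {x : ℝ} (hx : x ∈ I) (u : ℝ) :
    HasDerivAt (fun x => fundSol z w x u) (z' x * w u - z u * w' x) x :=
  ((h.deriv_fst x hx).mul_const _).sub ((h.deriv_snd x hx).const_mul _)

lemma hasDerivAt_deriv_fundSol (h : IsSolutionPair I q z w z' w') {x : ℝ} (hx : x ∈ I) (u : ℝ) :
    HasDerivAt (fun x => z' x * w u - z u * w' x) (q x * fundSol z w x u) x := by
  refine (((h.deriv_deriv_fst x hx).mul_const (w u)).sub
    ((h.deriv_deriv_snd x hx).const_mul (z u))).congr_deriv ?_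
  unfold fundSol; ring

/-- Crude form of the expansion, uniform near `x₀`. -/
lemma exists_fundSol_bounds (h : IsSolutionPair I q z w z' w') (hI : IsOpen I) {x₀ : ℝ}
    (hx₀ : x₀ ∈ I) (hq : ContinuousAt q x₀) :
    ∃ C δ : ℝ, 0 < C ∧ 0 < δ ∧ Metric.ball x₀ δ ⊆ I ∧ ∀ x ∈ Metric.ball x₀ δ,
      |q x| ≤ C ∧ ∀ u ∈ Metric.ball x₀ δ, |fundSol z w x u - (x - u)| ≤ C * |x - u| ^ 3 := by
  have hz'c : ContinuousAt z' x₀ := (h.deriv_deriv_fst x₀ hx₀).continuousAt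
  have hw'c : ContinuousAt w' x₀ := (h.deriv_deriv_snd x₀ hx₀).continuousAt
  have hzc : ContinuousAt z x₀ := (h.deriv_fst x₀ hx₀).continuousAt
  have hwc : ContinuousAt w x₀ := (h.deriv_snd x₀ hx₀).continuousAt
  set B : ℝ := |z' x₀| + |w' x₀| + |z x₀| + |w x₀| + |q x₀| + 1 with hB
  have hB0 : 0 < B := by positivity
  have hev : ∀ {F : ℝ → ℝ}, ContinuousAt F x₀ → |F x₀| < B → ∀ᶠ x in 𝓝 x₀, |F x| < B :=
    fun hF hlt => hF.abs.eventually_lt_const hlt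
  have p1 := abs_nonneg (z' x₀)
  have p2 := abs_nonneg (w' x₀)
  have p3 := abs_nonneg (z x₀)
  have p4 := abs_nonneg (w x₀)
  have p5 := abs_nonneg (q x₀)
  have hall := (hev hz'c (by linarith)).and ((hev hw'c (by linarith)).and
    ((hev hzc (by linarith)).and ((hev hwc (by linarith)).and
    ((hev hq (by linarith)).and (hI.mem_nhds hx₀)))))
  obtain ⟨δ, hδ, hball⟩ := Metric.eventually_nhds_iff_ball.1 hall
  have hconv := convex_ball x₀ δ
  -- the first bound `|D(x,u)| ≤ 2B²|x-u|` only uses that `z` and `w` are Lipschitz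
  have hLz : ∀ x ∈ Metric.ball x₀ δ, ∀ u ∈ Metric.ball x₀ δ, |z x - z u| ≤ B * |x - u| :=
    fun x hx u hu => hconv.norm_image_sub_le_of_norm_hasDerivWithin_le
      (fun a ha => (h.deriv_fst a (hball a ha).2.2.2.2.2).hasDerivWithinAt)
      (fun a ha => (hball a ha).1.le) hu hx
  have hLw : ∀ x ∈ Metric.ball x₀ δ, ∀ u ∈ Metric.ball x₀ δ, |w x - w u| ≤ B * |x - u| :=
    fun x hx u hu => hconv.norm_image_sub_le_of_norm_hasDerivWithin_le
      (fun a ha => (h.deriv_snd a (hball a ha).2.2.2.2.2).hasDerivWithinAt)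
      (fun a ha => (hball a ha).2.1.le) hu hx
  have hD1 : ∀ x ∈ Metric.ball x₀ δ, ∀ u ∈ Metric.ball x₀ δ,
      |fundSol z w x u| ≤ 2 * B ^ 2 * |x - u| := by
    intro x hx u hu
    have e : fundSol z w x u = (z x - z u) * w u - z u * (w x - w u) := by
      unfold fundSol; ring
    have b1 : |(z x - z u) * w u| ≤ B * |x - u| * B := by
      rw [abs_mul]
      exact mul_le_mul (hLz x hx u hu) (hball u hu).2.2.2.1.le (abs_nonneg _) (by positivity)
    have b2 : |z u * (w x - w u)| ≤ B * (B * |x - u|) := by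
      rw [abs_mul]
      exact mul_le_mul (hball u hu).2.2.1.le (hLw x hx u hu) (abs_nonneg _) hB0.le
    rw [e]
    have := abs_sub ((z x - z u) * w u) (z u * (w x - w u))
    nlinarith
  refine ⟨B + 2 * B ^ 3, δ, by positivity, hδ, fun x hx => (hball x hx).2.2.2.2.2,
    fun x hx => ⟨?_, fun u hu => ?_⟩⟩
  · have := (hball x hx).2.2.2.2.1
    have : 0 < B ^ 3 := by positivity
    linarith
  · refine abs_le_of_second_deriv_le hconv hu
      (fun a ha => (h.hasDerivAt_fundSol (hball a ha).2.2.2.2.2 u).sub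
        ((hasDerivAt_id' a).sub_const u))
      (fun a ha => (h.hasDerivAt_deriv_fundSol (hball a ha).2.2.2.2.2 u).sub_const 1) ?_ ?_ ?_ x hx
    · simp [fundSol]
    · rw [h.wronskian u (hball u hu).2.2.2.2.2, sub_self]
    · intro a ha
      rw [abs_mul]
      have b := mul_le_mul (hball a ha).2.2.2.2.1.le (hD1 a ha u hu) (abs_nonneg _) hB0.le
      have : 0 ≤ B * |a - u| := by positivity
      nlinarith

/-- Third order expansion at the diagonal: up to `o(ρ) |x - u|³`, the fundamental solution is
`e + q(m) e³ / 6` with `e = x - u`, where `m` is the midpoint of `x` and `u` and `q` is replaced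
by its tangent at `x₀`. Symmetry forces the midpoint, since `D(x,u) = -D(u,x)`. -/
lemma fundSol_expansion (h : IsSolutionPair I q z w z' w') (hI : IsOpen I) {x₀ q₁ : ℝ}
    (hx₀ : x₀ ∈ I) (hq : HasDerivAt q q₁ x₀) {ε : ℝ} (hε : 0 < ε) :
    ∃ δ > 0, ∀ ρ < δ, ∀ x u, |x - x₀| ≤ ρ → |u - x₀| ≤ ρ →
      |fundSol z w x u - ((x - u) + (q x₀ + q₁ * ((x + u) / 2 - x₀)) / 6 * (x - u) ^ 3)|
        ≤ ε * ρ * |x - u| ^ 3 := by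
  obtain ⟨C, δ₁, hC, hδ₁, hball, hbd⟩ := h.exists_fundSol_bounds hI hx₀ hq.continuousAt
  have hlo := (hasDerivAt_iff_isLittleO.1 hq).def (half_pos hε)
  obtain ⟨δ₂, hδ₂, hlo⟩ := Metric.eventually_nhds_iff_ball.1 hlo
  refine ⟨min (min δ₁ δ₂) (ε / (8 * C ^ 2)), by positivity, fun ρ hρ x u hx hu => ?_⟩
  have hρ1 : ρ < δ₁ := hρ.trans_le ((min_le_left _ _).trans (min_le_left _ _))
  have hρ2 : ρ < δ₂ := hρ.trans_le ((min_le_left _ _).trans (min_le_right _ _))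
  have hρ3 : ρ * (8 * C ^ 2) < ε := (lt_div_iff₀ (by positivity)).1
    (hρ.trans_le (min_le_right _ _))
  have hρ0 : 0 ≤ ρ := (abs_nonneg _).trans hx
  have hcb : ∀ a ∈ Metric.closedBall x₀ ρ, |a - x₀| ≤ ρ := fun a ha => by
    rwa [Metric.mem_closedBall, Real.dist_eq] at ha
  have hsub1 : Metric.closedBall x₀ ρ ⊆ Metric.ball x₀ δ₁ := Metric.closedBall_subset_ball hρ1
  have hsub2 : Metric.closedBall x₀ ρ ⊆ Metric.ball x₀ δ₂ := Metric.closedBall_subset_ball hρ2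
  have hxm : x ∈ Metric.closedBall x₀ ρ := by rwa [Metric.mem_closedBall, Real.dist_eq]
  have hum : u ∈ Metric.closedBall x₀ ρ := by rwa [Metric.mem_closedBall, Real.dist_eq]
  have hP1 : ∀ a : ℝ, HasDerivAt
      (fun a => (a - u) + (q x₀ + q₁ * ((a + u) / 2 - x₀)) / 6 * (a - u) ^ 3)
      (1 + (q₁ / 12 * (a - u) ^ 3 + (q x₀ + q₁ * ((a + u) / 2 - x₀)) / 2 * (a - u) ^ 2)) a := by
    intro a
    have e := (hasDerivAt_id' a).sub_const u
    have m := ((((((hasDerivAt_id' a).add_const u).div_const 2).sub_const x₀).const_mul q₁).const_add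
      (q x₀)).div_const 6
    refine (e.add (m.mul (e.pow 3))).congr_deriv ?_
    simp only [Pi.pow_apply, Nat.cast_ofNat]
    ring
  have hP2 : ∀ a : ℝ, HasDerivAt
      (fun a => 1 + (q₁ / 12 * (a - u) ^ 3 + (q x₀ + q₁ * ((a + u) / 2 - x₀)) / 2 * (a - u) ^ 2))
      ((a - u) * (q x₀ + q₁ * (a - x₀))) a := by
    intro a
    have e := (hasDerivAt_id' a).sub_const u
    have m := ((((((hasDerivAt_id' a).add_const u).div_const 2).sub_const x₀).const_mul q₁).const_add
      (q x₀)).div_const 2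
    refine ((((e.pow 3).const_mul (q₁ / 12)).add (m.mul (e.pow 2))).const_add 1).congr_deriv ?_
    simp only [Pi.pow_apply, Nat.cast_ofNat]
    ring
  refine abs_le_of_second_deriv_le (convex_closedBall x₀ ρ) hum
    (fun a ha => (h.hasDerivAt_fundSol (hball (hsub1 ha)) u).sub (hP1 a))
    (fun a ha => (h.hasDerivAt_deriv_fundSol (hball (hsub1 ha)) u).sub (hP2 a)) ?_ ?_ ?_ x hxm
  · simp [fundSol]
  · have := h.wronskian u (hball (hsub1 hum))
    linear_combination this
  · intro a ha
    have e : q a * fundSol z w a u - (a - u) * (q x₀ + q₁ * (a - x₀)) =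
        q a * (fundSol z w a u - (a - u)) + (a - u) * (q a - q x₀ - (a - x₀) * q₁) := by ring
    have hq1 := (hbd a (hsub1 ha)).1
    have hq2 := (hbd a (hsub1 ha)).2 u (hsub1 hum)
    have hq3 : |q a - q x₀ - (a - x₀) * q₁| ≤ ε / 2 * ρ := by
      have := hlo a (hsub2 ha)
      simp only [smul_eq_mul, Real.norm_eq_abs] at this
      exact this.trans (mul_le_mul_of_nonneg_left (hcb a ha) (by positivity))
    have hau : |a - u| ≤ 2 * ρ := by
      have := abs_sub_le a x₀ u
      rw [abs_sub_comm x₀ u] at this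
      linarith [hcb a ha]
    rw [e]
    refine (abs_add_le _ _).trans ?_
    rw [abs_mul, abs_mul]
    have b1 : |q a| * |fundSol z w a u - (a - u)| ≤ C * (C * |a - u| ^ 3) :=
      mul_le_mul hq1 hq2 (abs_nonneg _) hC.le
    have b2 : |a - u| * |q a - q x₀ - (a - x₀) * q₁| ≤ |a - u| * (ε / 2 * ρ) :=
      mul_le_mul_of_nonneg_left hq3 (abs_nonneg _)
    have b3 : |a - u| ^ 2 ≤ (2 * ρ) ^ 2 := pow_le_pow_left₀ (abs_nonneg _) hau 2
    have b4 : C * (C * |a - u| ^ 3) ≤ |a - u| * (ε / 2 * ρ) := by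
      have c1 : C ^ 2 * |a - u| ^ 2 ≤ C ^ 2 * (2 * ρ) ^ 2 :=
        mul_le_mul_of_nonneg_left b3 (by positivity)
      have c2 : C ^ 2 * (2 * ρ) ^ 2 ≤ ε / 2 * ρ := by
        have := mul_le_mul_of_nonneg_right hρ3.le hρ0
        linarith
      have := mul_le_mul_of_nonneg_left (c1.trans c2) (abs_nonneg (a - u))
      linarith
    linarith

/-- The expansion along a filter, for `A = (D/e - 1)/e²`. -/
lemma tendsto_fundSol_coeff (h : IsSolutionPair I q z w z' w') (hI : IsOpen I) {x₀ q₁ : ℝ}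
    (hx₀ : x₀ ∈ I) (hq : HasDerivAt q q₁ x₀) {ι : Type*} {l : Filter ι} {X U ρ : ι → ℝ} {m : ℝ}
    (hρ : Tendsto ρ l (𝓝 0)) (hρ0 : ∀ᶠ i in l, 0 < ρ i)
    (hX : ∀ᶠ i in l, |X i - x₀| ≤ ρ i) (hU : ∀ᶠ i in l, |U i - x₀| ≤ ρ i)
    (hne : ∀ᶠ i in l, X i ≠ U i)
    (hm : Tendsto (fun i => ((X i + U i) / 2 - x₀) / ρ i) l (𝓝 m)) :
    Tendsto (fun i => ((fundSol z w (X i) (U i) / (X i - U i) - 1) / (X i - U i) ^ 2 - q x₀ / 6)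
      / ρ i) l (𝓝 (q₁ / 6 * m)) := by
  have hmain := hm.const_mul (q₁ / 6)
  refine (tendsto_iff_of_dist ?_).1 hmain
  rw [Metric.tendsto_nhds]
  intro ε hε
  obtain ⟨δ, hδ, H⟩ := h.fundSol_expansion hI hx₀ hq (half_pos hε)
  filter_upwards [hρ.eventually_lt_const hδ, hρ0, hX, hU, hne] with i h1 h2 h3 h4 h5
  have hH := H (ρ i) h1 (X i) (U i) h3 h4
  have he : X i - U i ≠ 0 := sub_ne_zero.2 h5
  rw [Real.dist_0_eq_abs, abs_of_nonneg dist_nonneg, dist_comm, Real.dist_eq]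
  have e : ((fundSol z w (X i) (U i) / (X i - U i) - 1) / (X i - U i) ^ 2 - q x₀ / 6) / ρ i
      - q₁ / 6 * (((X i + U i) / 2 - x₀) / ρ i) =
      (fundSol z w (X i) (U i) - ((X i - U i) + (q x₀ + q₁ * ((X i + U i) / 2 - x₀)) / 6
        * (X i - U i) ^ 3)) / (ρ i * (X i - U i) ^ 3) := by
    field_simp
    ring
  have hpos : 0 < |X i - U i| ^ 3 := by positivity
  rw [e, abs_div, abs_mul, abs_of_pos h2, abs_pow, div_lt_iff₀ (by positivity)]
  refine hH.trans_lt ?_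
  have : 0 < ε * ρ i * |X i - U i| ^ 3 := by positivity
  linarith

end IsSolutionPair

/-! ### Consequences of the invariance equation at the diagonal -/

/-- To first order the fundamental solution at the diagonal is `x - u`. -/
lemma IsSolutionPair.tendsto_fundSol_div {I : Set ℝ} {q z w z' w' : ℝ → ℝ}
    (h : IsSolutionPair I q z w z' w') (hI : IsOpen I) {x₀ : ℝ} (hx₀ : x₀ ∈ I)
    (hq : ContinuousAt q x₀) {ι : Type*} {l : Filter ι} {X U : ι → ℝ}
    (hX : Tendsto X l (𝓝 x₀)) (hU : Tendsto U l (𝓝 x₀)) (hne : ∀ᶠ i in l, X i ≠ U i) :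
    Tendsto (fun i => fundSol z w (X i) (U i) / (X i - U i)) l (𝓝 1) := by
  obtain ⟨C, δ, hC, hδ, -, hbd⟩ := h.exists_fundSol_bounds hI hx₀ hq
  have hlim : Tendsto (fun i => C * |X i - U i| ^ 2) l (𝓝 0) := by
    have := (((hX.sub hU).abs).pow 2).const_mul C
    simpa using this
  rw [tendsto_iff_dist_tendsto_zero]
  refine squeeze_zero' (Eventually.of_forall fun _ => dist_nonneg) ?_ hlim
  filter_upwards [hX.eventually_mem (Metric.ball_mem_nhds x₀ hδ),
    hU.eventually_mem (Metric.ball_mem_nhds x₀ hδ), hne] with i h1 h2 h3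
  have he : X i - U i ≠ 0 := sub_ne_zero.2 h3
  have hpos : 0 < |X i - U i| := abs_pos.2 he
  have := (hbd _ h1).2 _ h2
  rw [Real.dist_eq, div_sub_one he, abs_div, div_le_iff₀ hpos]
  linarith

/-- Asymptotic data at the diagonal point `x₀`, for `y = x₀ + ρ` with `ρ ↓ 0`: with
`v = x₀ + y - u`, `a = y - u = ρ α` and `b = u - x₀ = ρ β`, the quotients `D/e` of the fundamental solutions are
`1 + b² Ax = D₁(x₀,u)/(x₀-u)`, `1 + a² Bx = D₂(x₀,v)/(x₀-v)`, `1 + a² Ay = D₁(y,u)/(y-u)` and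
`1 + b² By = D₂(y,v)/(y-v)`. -/
lemma exists_diagonal_asymptotics {I : Set ℝ} (hI : IsOpen I) {x₀ t s p₀ p₁ q₀ q₁ : ℝ}
    {P z₁ w₁ z₁' w₁' Q z₂ w₂ z₂' w₂' φ₁ φ₂ : ℝ → ℝ}
    (ht : 0 < t) (hs : 0 < s) (hx₀ : x₀ ∈ I)
    (h₁ : IsSolutionPair I P z₁ w₁ z₁' w₁') (h₂ : IsSolutionPair I Q z₂ w₂ z₂' w₂')
    (hP : HasDerivAt P p₁ x₀) (hQ : HasDerivAt Q q₁ x₀) (hp₀ : P x₀ = p₀) (hq₀ : Q x₀ = q₀)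
    (hφ₁ : 0 < φ₁ x₀) (hφ₁c : ContinuousAt φ₁ x₀)
    (heq : ∀ y ∈ I, x₀ < y → ∃ u ∈ Set.Ioo x₀ y,
      t * (φ₁ x₀ * fundSol z₁ w₁ x₀ u) + s * (φ₁ y * fundSol z₁ w₁ y u) = 0 ∧
      s * (φ₂ x₀ * fundSol z₂ w₂ x₀ (x₀ + y - u))
        + t * (φ₂ y * fundSol z₂ w₂ y (x₀ + y - u)) = 0) :
    ∃ α β Ax Bx Ay By : ℝ → ℝ,
      Tendsto α (𝓝[>] 0) (𝓝 (t / (t + s))) ∧ Tendsto β (𝓝[>] 0) (𝓝 (s / (t + s))) ∧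
      Tendsto (fun ρ => (Ax ρ - p₀ / 6) / ρ) (𝓝[>] 0) (𝓝 (p₁ / 6 * (s / (t + s) / 2))) ∧
      Tendsto (fun ρ => (Bx ρ - q₀ / 6) / ρ) (𝓝[>] 0) (𝓝 (q₁ / 6 * (t / (t + s) / 2))) ∧
      Tendsto (fun ρ => (Ay ρ - p₀ / 6) / ρ) (𝓝[>] 0) (𝓝 (p₁ / 6 * ((1 + s / (t + s)) / 2))) ∧
      Tendsto (fun ρ => (By ρ - q₀ / 6) / ρ) (𝓝[>] 0) (𝓝 (q₁ / 6 * ((1 + t / (t + s)) / 2))) ∧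
      ∀ᶠ ρ in 𝓝[>] 0,
        φ₁ x₀ * φ₂ x₀ * ((1 + (ρ * β ρ) ^ 2 * Ax ρ) * (1 + (ρ * α ρ) ^ 2 * Bx ρ)) =
        φ₁ (x₀ + ρ) * φ₂ (x₀ + ρ) *
          ((1 + (ρ * α ρ) ^ 2 * Ay ρ) * (1 + (ρ * β ρ) ^ 2 * By ρ)) := by
  choose! u hu heq₁ heq₂ using heq
  set U : ℝ → ℝ := fun ρ => u (x₀ + ρ) with hUdef
  have hρ : Tendsto (fun ρ : ℝ => ρ) (𝓝[>] 0) (𝓝 0) := tendsto_id.mono_left nhdsWithin_le_nhds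
  have hpos : ∀ᶠ ρ : ℝ in 𝓝[>] 0, 0 < ρ := eventually_mem_nhdsWithin
  have hy : Tendsto (fun ρ : ℝ => x₀ + ρ) (𝓝[>] 0) (𝓝 x₀) := by
    simpa using hρ.const_add x₀
  have hyI : ∀ᶠ ρ : ℝ in 𝓝[>] 0, x₀ + ρ ∈ I := hy.eventually_mem (hI.mem_nhds hx₀)
  have hUm : ∀ᶠ ρ : ℝ in 𝓝[>] 0, x₀ < U ρ ∧ U ρ < x₀ + ρ := by
    filter_upwards [hpos, hyI] with ρ h1 h2
    exact hu _ h2 (by linarith)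
  have hUt : Tendsto U (𝓝[>] 0) (𝓝 x₀) :=
    tendsto_of_tendsto_of_tendsto_of_le_of_le' tendsto_const_nhds hy
      (hUm.mono fun _ h => h.1.le) (hUm.mono fun _ h => h.2.le)
  set β : ℝ → ℝ := fun ρ => (U ρ - x₀) / ρ with hβ
  -- the first order behaviour of `D₁` turns the implicit equation into an equation for `β`
  have hE1 := h₁.tendsto_fundSol_div hI hx₀ hP.continuousAt (X := fun _ => x₀)
    tendsto_const_nhds hUt (hUm.mono fun _ h => h.1.ne)
  have hE2 := h₁.tendsto_fundSol_div hI hx₀ hP.continuousAt hy hUt (hUm.mono fun _ h => h.2.ne')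
  have hc := hE1.const_mul (t * φ₁ x₀)
  have hd := ((hφ₁c.tendsto.comp hy).const_mul s).mul hE2
  have hlim : s * φ₁ x₀ * 1 / (t * φ₁ x₀ * 1 + s * φ₁ x₀ * 1) = s / (t + s) := by
    field_simp
  have hts : 0 < t + s := by linarith
  have hβt : Tendsto β (𝓝[>] 0) (𝓝 (s / (t + s))) := by
    rw [← hlim]
    refine (hd.div (hc.add hd) (by positivity)).congr' ?_
    have hne := (hc.add hd).eventually_ne
      (show t * φ₁ x₀ * 1 + s * φ₁ x₀ * 1 ≠ 0 by positivity)
    filter_upwards [hpos, hyI, hUm, hne] with ρ h1 h2 h3 h4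
    have e := heq₁ _ h2 (by linarith)
    have n1 : x₀ - U ρ ≠ 0 := by linarith [h3.1]
    have n2 : x₀ + ρ - U ρ ≠ 0 := by linarith [h3.2]
    rw [Pi.div_apply, div_eq_iff h4]
    simp only [Function.comp_apply, hβ]
    change t * (φ₁ x₀ * fundSol z₁ w₁ x₀ (U ρ))
      + s * (φ₁ (x₀ + ρ) * fundSol z₁ w₁ (x₀ + ρ) (U ρ)) = 0 at e
    field_simp
    linear_combination (x₀ - U ρ) * (x₀ + ρ - U ρ) * e
  have hαt : Tendsto (fun ρ => 1 - β ρ) (𝓝[>] 0) (𝓝 (t / (t + s))) := by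
    have e : t / (t + s) = 1 - s / (t + s) := by field_simp; ring
    rw [e]
    exact hβt.const_sub 1
  set V : ℝ → ℝ := fun ρ => x₀ + (x₀ + ρ) - U ρ with hV
  have hx₀b : ∀ᶠ ρ : ℝ in 𝓝[>] 0, |x₀ - x₀| ≤ ρ := by
    filter_upwards [hpos] with ρ h1
    simpa using h1.le
  have hyb : ∀ᶠ ρ : ℝ in 𝓝[>] 0, |x₀ + ρ - x₀| ≤ ρ := by
    filter_upwards [hpos] with ρ h1
    rw [add_sub_cancel_left, abs_of_pos h1]
  have hUb : ∀ᶠ ρ : ℝ in 𝓝[>] 0, |U ρ - x₀| ≤ ρ := by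
    filter_upwards [hUm] with ρ h1
    rw [abs_le]; constructor <;> linarith [h1.1, h1.2]
  have hVb : ∀ᶠ ρ : ℝ in 𝓝[>] 0, |V ρ - x₀| ≤ ρ := by
    filter_upwards [hUm] with ρ h1
    simp only [hV]
    rw [abs_le]; constructor <;> linarith [h1.1, h1.2]
  refine ⟨fun ρ => 1 - β ρ, β,
    fun ρ => (fundSol z₁ w₁ x₀ (U ρ) / (x₀ - U ρ) - 1) / (x₀ - U ρ) ^ 2,
    fun ρ => (fundSol z₂ w₂ x₀ (V ρ) / (x₀ - V ρ) - 1) / (x₀ - V ρ) ^ 2,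
    fun ρ => (fundSol z₁ w₁ (x₀ + ρ) (U ρ) / (x₀ + ρ - U ρ) - 1) / (x₀ + ρ - U ρ) ^ 2,
    fun ρ => (fundSol z₂ w₂ (x₀ + ρ) (V ρ) / (x₀ + ρ - V ρ) - 1) / (x₀ + ρ - V ρ) ^ 2,
    hαt, hβt, ?_, ?_, ?_, ?_, ?_⟩
  · rw [← hp₀]
    refine h₁.tendsto_fundSol_coeff hI hx₀ hP (X := fun _ => x₀) hρ hpos hx₀b hUb
      (hUm.mono fun _ h => h.1.ne) ((hβt.div_const 2).congr' ?_)
    filter_upwards [hpos] with ρ h1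
    simp only [hβ]; field_simp; ring
  · rw [← hq₀]
    refine h₂.tendsto_fundSol_coeff hI hx₀ hQ (X := fun _ => x₀) hρ hpos hx₀b hVb
      (hUm.mono fun _ h => ?_) ((hαt.div_const 2).congr' ?_)
    · simp only [hV]; linarith [h.2]
    filter_upwards [hpos] with ρ h1
    simp only [hβ, hV]; field_simp; ring
  · rw [← hp₀]
    refine h₁.tendsto_fundSol_coeff hI hx₀ hP hρ hpos hyb hUb
      (hUm.mono fun _ h => h.2.ne') (((hβt.const_add 1).div_const 2).congr' ?_)
    filter_upwards [hpos] with ρ h1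
    simp only [hβ]; field_simp; ring
  · rw [← hq₀]
    refine h₂.tendsto_fundSol_coeff hI hx₀ hQ hρ hpos hyb hVb
      (hUm.mono fun _ h => ?_) (((hαt.const_add 1).div_const 2).congr' ?_)
    · simp only [hV]; linarith [h.1]
    filter_upwards [hpos] with ρ h1
    simp only [hβ, hV]; field_simp; ring
  · filter_upwards [hpos, hyI, hUm] with ρ h1 h2 h3
    have e₁ := heq₁ _ h2 (by linarith)
    have e₂ := heq₂ _ h2 (by linarith)
    change t * (φ₁ x₀ * fundSol z₁ w₁ x₀ (U ρ))
      + s * (φ₁ (x₀ + ρ) * fundSol z₁ w₁ (x₀ + ρ) (U ρ)) = 0 at e₁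
    change s * (φ₂ x₀ * fundSol z₂ w₂ x₀ (V ρ))
      + t * (φ₂ (x₀ + ρ) * fundSol z₂ w₂ (x₀ + ρ) (V ρ)) = 0 at e₂
    have hb : 0 < U ρ - x₀ := by linarith [h3.1]
    have ha : 0 < x₀ + ρ - U ρ := by linarith [h3.2]
    have r1 : x₀ - U ρ = -(U ρ - x₀) := by ring
    have r2 : x₀ - V ρ = -(x₀ + ρ - U ρ) := by simp only [hV]; ring
    have r3 : x₀ + ρ - V ρ = U ρ - x₀ := by simp only [hV]; ring
    have r4 : ρ * β ρ = U ρ - x₀ := by simp only [hβ]; field_simp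
    have r5 : ρ * (1 - β ρ) = x₀ + ρ - U ρ := by rw [mul_sub, r4]; ring
    rw [r1, r2, r3, r4, r5]
    generalize U ρ - x₀ = b at *
    generalize x₀ + ρ - U ρ = a at *
    rw [neg_sq, neg_sq, mul_div_cancel₀ _ (by positivity), mul_div_cancel₀ _ (by positivity),
      mul_div_cancel₀ _ (by positivity), mul_div_cancel₀ _ (by positivity)]
    simp only [add_sub_cancel, div_neg]
    have hmul : t * s * (φ₁ x₀ * φ₂ x₀ * (fundSol z₁ w₁ x₀ (U ρ) * fundSol z₂ w₂ x₀ (V ρ))) =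
        t * s * (φ₁ (x₀ + ρ) * φ₂ (x₀ + ρ) *
          (fundSol z₁ w₁ (x₀ + ρ) (U ρ) * fundSol z₂ w₂ (x₀ + ρ) (V ρ))) := by
      linear_combination s * φ₂ x₀ * fundSol z₂ w₂ x₀ (V ρ) * e₁
        - s * φ₁ (x₀ + ρ) * fundSol z₁ w₁ (x₀ + ρ) (U ρ) * e₂
    have := mul_left_cancel₀ (by positivity) hmul
    field_simp
    linear_combination this

lemma tendsto_of_tendsto_sub_div {F : ℝ → ℝ} {c m : ℝ}
    (h : Tendsto (fun ρ => (F ρ - c) / ρ) (𝓝[>] 0) (𝓝 m)) : Tendsto F (𝓝[>] 0) (𝓝 c) := by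
  have hρ : Tendsto (fun ρ : ℝ => ρ) (𝓝[>] 0) (𝓝 0) := tendsto_id.mono_left nhdsWithin_le_nhds
  have h1 := (h.mul hρ).add_const c
  rw [mul_zero, zero_add] at h1
  refine h1.congr' ?_
  filter_upwards [eventually_mem_nhdsWithin] with ρ (hr : 0 < ρ)
  field_simp
  ring

/-- The first order information: the product `φ₁ φ₂` has vanishing right derivative. -/
lemma hasDerivWithinAt_zero_of_asymptotics {M α β Ax Bx Ay By : ℝ → ℝ} {x₀ α₀ β₀ p q : ℝ}
    (hM : ContinuousAt M x₀) (hα : Tendsto α (𝓝[>] 0) (𝓝 α₀)) (hβ : Tendsto β (𝓝[>] 0) (𝓝 β₀))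
    (hAx : Tendsto Ax (𝓝[>] 0) (𝓝 p)) (hBx : Tendsto Bx (𝓝[>] 0) (𝓝 q))
    (hAy : Tendsto Ay (𝓝[>] 0) (𝓝 p)) (hBy : Tendsto By (𝓝[>] 0) (𝓝 q))
    (h : ∀ᶠ ρ in 𝓝[>] 0,
      M x₀ * ((1 + (ρ * β ρ) ^ 2 * Ax ρ) * (1 + (ρ * α ρ) ^ 2 * Bx ρ)) =
      M (x₀ + ρ) * ((1 + (ρ * α ρ) ^ 2 * Ay ρ) * (1 + (ρ * β ρ) ^ 2 * By ρ))) :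
    HasDerivWithinAt M 0 (Set.Ici x₀) x₀ := by
  have hρ : Tendsto (fun ρ : ℝ => ρ) (𝓝[>] 0) (𝓝 0) := tendsto_id.mono_left nhdsWithin_le_nhds
  have hy : Tendsto (fun ρ : ℝ => x₀ + ρ) (𝓝[>] 0) (𝓝 x₀) := by
    simpa using hρ.const_add x₀
  rw [← hasDerivWithinAt_Ioi_iff_Ici, hasDerivWithinAt_iff_tendsto_slope' (by simp)]
  -- `M y - M x₀` is `ρ` times an explicit quantity that tends to `0`
  have hα2 := hα.pow 2
  have hβ2 := hβ.pow 2
  have hMy := hM.tendsto.comp hy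
  have hlim := ((hρ.mul (((hβ2.mul hAx).add (hα2.mul hBx)).add
      (((hρ.pow 2).mul ((hβ2.mul hα2).mul (hAx.mul hBx)))))).const_mul (M x₀)).sub
    ((hρ.mul (((hα2.mul hAy).add (hβ2.mul hBy)).add
      (((hρ.pow 2).mul ((hβ2.mul hα2).mul (hAy.mul hBy)))))).mul hMy)
  have hz : M x₀ * (0 * (β₀ ^ 2 * p + α₀ ^ 2 * q + 0 ^ 2 * (β₀ ^ 2 * α₀ ^ 2 * (p * q)))) -
    0 * (α₀ ^ 2 * p + β₀ ^ 2 * q + 0 ^ 2 * (β₀ ^ 2 * α₀ ^ 2 * (p * q))) * M x₀ = 0 := by ring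
  rw [hz] at hlim
  have hmap : 𝓝[>] x₀ = Filter.map (fun ρ => x₀ + ρ) (𝓝[>] 0) := by
    rw [map_add_left_nhdsGT, add_zero]
  rw [hmap, tendsto_map'_iff]
  refine hlim.congr' ?_
  filter_upwards [h, eventually_mem_nhdsWithin] with ρ h1 (h2 : 0 < ρ)
  simp only [Function.comp_apply, slope_def_field, add_sub_cancel_left]
  rw [eq_div_iff h2.ne']
  linear_combination h1

/-- The higher order information: if `φ₁ φ₂` is constant, the second order terms force `p₀ = q₀`
since the limits `t/(t+s)` and `s/(t+s)` differ, and then the third order terms force the common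
derivative to vanish. -/
lemma coeff_eq_of_asymptotics {α β Ax Bx Ay By : ℝ → ℝ} {α₀ β₀ p₀ q₀ ax bx ay bw : ℝ}
    (hα : Tendsto α (𝓝[>] 0) (𝓝 α₀)) (hβ : Tendsto β (𝓝[>] 0) (𝓝 β₀))
    (hne : α₀ ^ 2 ≠ β₀ ^ 2)
    (hAx : Tendsto (fun ρ => (Ax ρ - p₀ / 6) / ρ) (𝓝[>] 0) (𝓝 ax))
    (hBx : Tendsto (fun ρ => (Bx ρ - q₀ / 6) / ρ) (𝓝[>] 0) (𝓝 bx))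
    (hAy : Tendsto (fun ρ => (Ay ρ - p₀ / 6) / ρ) (𝓝[>] 0) (𝓝 ay))
    (hBy : Tendsto (fun ρ => (By ρ - q₀ / 6) / ρ) (𝓝[>] 0) (𝓝 bw))
    (h : ∀ᶠ ρ in 𝓝[>] 0,
      (1 + (ρ * β ρ) ^ 2 * Ax ρ) * (1 + (ρ * α ρ) ^ 2 * Bx ρ) =
      (1 + (ρ * α ρ) ^ 2 * Ay ρ) * (1 + (ρ * β ρ) ^ 2 * By ρ)) :
    p₀ = q₀ ∧ α₀ ^ 2 * (ay - bx) + β₀ ^ 2 * (bw - ax) = 0 := by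
  have hρ : Tendsto (fun ρ : ℝ => ρ) (𝓝[>] 0) (𝓝 0) := tendsto_id.mono_left nhdsWithin_le_nhds
  have lAx := tendsto_of_tendsto_sub_div hAx
  have lBx := tendsto_of_tendsto_sub_div hBx
  have lAy := tendsto_of_tendsto_sub_div hAy
  have lBy := tendsto_of_tendsto_sub_div hBy
  have hα2 := hα.pow 2
  have hβ2 := hβ.pow 2
  have hR := (hα2.mul hβ2).mul ((lAy.mul lBy).sub (lAx.mul lBx))
  have hpq : p₀ = q₀ := by
    have h2 := ((hα2.mul (lAy.sub lBx)).add (hβ2.mul (lBy.sub lAx))).add ((hρ.pow 2).mul hR)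
    have h0 := h2.congr' (f₂ := fun _ => (0 : ℝ)) (by
      filter_upwards [h, eventually_mem_nhdsWithin] with ρ h1 (hr : 0 < ρ)
      refine (mul_eq_zero.1 (?_ : ρ ^ 2 * _ = 0)).resolve_left (by positivity)
      linear_combination -h1)
    have h3 := tendsto_nhds_unique h0 tendsto_const_nhds
    have h4 : (α₀ ^ 2 - β₀ ^ 2) * (p₀ - q₀) = 0 := by linear_combination 6 * h3
    exact sub_eq_zero.1 ((mul_eq_zero.1 h4).resolve_left (sub_ne_zero.2 hne))
  refine ⟨hpq, ?_⟩
  subst hpq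
  have h2 := ((hα2.mul (hAy.sub hBx)).add (hβ2.mul (hBy.sub hAx))).add (hρ.mul hR)
  have h0 := h2.congr' (f₂ := fun _ => (0 : ℝ)) (by
    filter_upwards [h, eventually_mem_nhdsWithin] with ρ h1 (hr : 0 < ρ)
    refine (mul_eq_zero.1 (?_ : ρ ^ 3 * _ = 0)).resolve_left (by positivity)
    field_simp
    linear_combination -6 * h1)
  have h3 := tendsto_nhds_unique h0 tendsto_const_nhds
  linear_combination h3

/-! ### Constant coefficients -/

/-- A function that is continuous on an interval and has right derivative zero is constant. -/
lemma eq_of_right_deriv_zero {I : Set ℝ} (hI' : I.OrdConnected) {M : ℝ → ℝ}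
    (hM : ContinuousOn M I) (hd : ∀ x ∈ I, HasDerivWithinAt M 0 (Set.Ici x) x) {x y : ℝ}
    (hx : x ∈ I) (hy : y ∈ I) : M x = M y := by
  have key : ∀ a ∈ I, ∀ b ∈ I, a ≤ b → M b = M a := fun a ha b hb hab =>
    constant_of_has_deriv_right_zero (hM.mono (hI'.out ha hb))
      (fun c hc => hd c (hI'.out ha hb ⟨hc.1, hc.2.le⟩)) b ⟨hab, le_rfl⟩
  rcases le_total x y with h | h
  · exact (key x hx y hy h).symm
  · exact key y hy x hx h

lemma eq_of_hasDerivAt_zero {I : Set ℝ} (hI' : I.OrdConnected) {M : ℝ → ℝ}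
    (hd : ∀ x ∈ I, HasDerivAt M 0 x) {x y : ℝ} (hx : x ∈ I) (hy : y ∈ I) : M x = M y :=
  eq_of_right_deriv_zero hI' (fun a ha => (hd a ha).continuousAt.continuousWithinAt)
    (fun a ha => (hd a ha).hasDerivWithinAt) hx hy

/-- Any solution pair of `y'' = p y` spans the same space as `S_p`, `C_p`, by constancy of
Wronskians. -/
lemma IsSolutionPair.exists_sineType_eq {I : Set ℝ} (hI' : I.OrdConnected) (hne : I.Nonempty)
    {p : ℝ} {q z w z' w' : ℝ → ℝ} (h : IsSolutionPair I q z w z' w') (hq : ∀ x ∈ I, q x = p) :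
    ∃ a b c d : ℝ, a * d ≠ b * c ∧ (∀ x ∈ I, sineType p x = a * z x + b * w x) ∧
      (∀ x ∈ I, cosineType p x = c * z x + d * w x) := by
  obtain ⟨ω, κ, hω, hp, hS, hC, hSC⟩ := exists_sineType_hasDerivAt p
  obtain ⟨x₀, hx₀⟩ := hne
  have hWr : ∀ {Y Y' v v' : ℝ → ℝ}, (∀ x, HasDerivAt Y (Y' x) x) →
      (∀ x, HasDerivAt Y' (p * Y x) x) → (∀ x ∈ I, HasDerivAt v (v' x) x) →
      (∀ x ∈ I, HasDerivAt v' (q x * v x) x) → ∀ x ∈ I,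
      Y' x * v x - Y x * v' x = Y' x₀ * v x₀ - Y x₀ * v' x₀ := by
    intro Y Y' v v' h1 h2 h3 h4 x hx
    refine eq_of_hasDerivAt_zero (M := fun x => Y' x * v x - Y x * v' x) hI'
      (fun a ha => ?_) hx hx₀
    refine (((h2 a).mul (h3 a ha)).sub ((h1 a).mul (h4 a ha))).congr_deriv ?_
    rw [hq a ha]; ring
  have hS' : ∀ x, HasDerivAt (fun x => ω * cosineType p x) (p * sineType p x) x := fun x =>
    ((hC x).const_mul ω).congr_deriv (by rw [← hp]; ring)
  have hC' : ∀ x, HasDerivAt (fun x => κ * sineType p x) (p * cosineType p x) x := fun x =>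
    ((hS x).const_mul κ).congr_deriv (by rw [← hp]; ring)
  have e1 := hWr hS hS' h.deriv_snd h.deriv_deriv_snd
  have e2 := hWr hS hS' h.deriv_fst h.deriv_deriv_fst
  have e3 := hWr hC hC' h.deriv_snd h.deriv_deriv_snd
  have e4 := hWr hC hC' h.deriv_fst h.deriv_deriv_fst
  refine ⟨ω * cosineType p x₀ * w x₀ - sineType p x₀ * w' x₀,
    -(ω * cosineType p x₀ * z x₀ - sineType p x₀ * z' x₀),
    κ * sineType p x₀ * w x₀ - cosineType p x₀ * w' x₀,
    -(κ * sineType p x₀ * z x₀ - cosineType p x₀ * z' x₀), ?_, fun x hx => ?_, fun x hx => ?_⟩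
  rotate_left
  · rw [← e1 x hx, ← e2 x hx]
    linear_combination (-sineType p x) * h.wronskian x hx
  · rw [← e3 x hx, ← e4 x hx]
    linear_combination (-cosineType p x) * h.wronskian x hx
  · intro hdet
    refine hω ?_
    have h1 := h.wronskian x₀ hx₀
    have h2 := hSC x₀
    linear_combination (-1) * h2 - (ω * cosineType p x₀ ^ 2 - κ * sineType p x₀ ^ 2) * h1 + hdet

/-- Solution pairs for a constant `q = p` in terms of the original functions. -/
lemma IsSolutionPair.pairEquiv_sineType_mul {I : Set ℝ} (hI' : I.OrdConnected)
    (hne : I.Nonempty) {p σ : ℝ} {f g φ q z w z' w' : ℝ → ℝ} (h : IsSolutionPair I q z w z' w')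
    (hq : ∀ x ∈ I, q x = p) (hσ : σ ≠ 0) (hf : ∀ x ∈ I, f x = σ * (φ x * z x))
    (hg : ∀ x ∈ I, g x = φ x * w x) :
    pairEquiv I f g (fun x => sineType p x * φ x) (fun x => cosineType p x * φ x) := by
  obtain ⟨a, b, c, d, hdet, hS, hC⟩ := h.exists_sineType_eq hI' hne hq
  refine ⟨a / σ, b, c / σ, d, fun hd => hdet ?_, fun x hx => ?_, fun x hx => ?_⟩
  · field_simp at hd
    exact hd
  · simp only [hS x hx, hf x hx, hg x hx]
    field_simp
  · simp only [hC x hx, hf x hx, hg x hx]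
    field_simp

/-! ### Necessity -/

/-- The implicit equations of the two means, in terms of fundamental solutions. -/
lemma invarianceEq.exists_fundSol_eq {I : Set ℝ} (hI' : I.OrdConnected)
    {f g h k φ₁ z₁ w₁ φ₂ z₂ w₂ : ℝ → ℝ} {t s σ₁ σ₂ : ℝ} (hinv : invarianceEq I f g h k t s)
    (hfg : regClass I 0 f g) (hhk : regClass I 0 h k) (ht : 0 < t) (hs : 0 < s)
    (hσ₁ : σ₁ ≠ 0) (hσ₂ : σ₂ ≠ 0) (hφ₁ : ∀ x ∈ I, 0 < φ₁ x) (hφ₂ : ∀ x ∈ I, 0 < φ₂ x)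
    (hf : ∀ x ∈ I, f x = σ₁ * (φ₁ x * z₁ x)) (hg : ∀ x ∈ I, g x = φ₁ x * w₁ x)
    (hh : ∀ x ∈ I, h x = σ₂ * (φ₂ x * z₂ x)) (hk : ∀ x ∈ I, k x = φ₂ x * w₂ x)
    {x y : ℝ} (hx : x ∈ I) (hy : y ∈ I) (hxy : x < y) :
    ∃ u ∈ Set.Ioo x y,
      t * (φ₁ x * fundSol z₁ w₁ x u) + s * (φ₁ y * fundSol z₁ w₁ y u) = 0 ∧
      s * (φ₂ x * fundSol z₂ w₂ x (x + y - u)) + t * (φ₂ y * fundSol z₂ w₂ y (x + y - u)) = 0 := by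
  obtain ⟨u, hu, hum, hue⟩ := mean_spec_strict hI' hfg hx hy hxy ht hs
  obtain ⟨v, hv, hvm, hve⟩ := mean_spec_strict hI' hhk hx hy hxy hs ht
  have huv : v = x + y - u := by
    have := hinv x hx y hy
    rw [hum, hvm] at this
    linarith
  have huI : u ∈ I := hI'.out hx hy (Set.Ioo_subset_Icc_self hu)
  have hvI : v ∈ I := hI'.out hx hy (Set.Ioo_subset_Icc_self hv)
  refine ⟨u, hu, ?_, ?_⟩
  · refine (mul_eq_zero.1 (?_ : σ₁ * φ₁ u * _ = 0)).resolve_left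
      (mul_ne_zero hσ₁ (hφ₁ u huI).ne')
    rw [hf x hx, hf u huI, hf y hy, hg x hx, hg u huI, hg y hy] at hue
    unfold fundSol
    linear_combination hue
  · rw [← huv]
    refine (mul_eq_zero.1 (?_ : σ₂ * φ₂ v * _ = 0)).resolve_left
      (mul_ne_zero hσ₂ (hφ₂ v hvI).ne')
    rw [hh x hx, hh v hvI, hh y hy, hk x hx, hk v hvI, hk y hy] at hve
    unfold fundSol
    linear_combination hve

/-- The function `φ₁` inherits the regularity of `S_p φ₁` and `C_p φ₁`, since
`C_p² - (κ/ω) S_p² = 1`. -/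
lemma contDiffOn_of_pairEquiv {I : Set ℝ} {f g φ : ℝ → ℝ} {p : ℝ} {n : WithTop ℕ∞}
    (hf : ContDiffOn ℝ n f I) (hg : ContDiffOn ℝ n g I)
    (h : pairEquiv I f g (fun x => sineType p x * φ x) (fun x => cosineType p x * φ x)) :
    ContDiffOn ℝ n φ I := by
  obtain ⟨a, b, c, d, -, hS, hC⟩ := h
  obtain ⟨ω, κ, hω, -, -, -, hSC⟩ := exists_sineType_hasDerivAt p
  have hcd : ContDiffOn ℝ n (fun x => cosineType p x * (c * f x + d * g x)
      - κ / ω * (sineType p x * (a * f x + b * g x))) I :=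
    ((contDiff_cosineType p).contDiffOn.mul
      ((contDiffOn_const.mul hf).add (contDiffOn_const.mul hg))).sub
      (contDiffOn_const.mul ((contDiff_sineType p).contDiffOn.mul
        ((contDiffOn_const.mul hf).add (contDiffOn_const.mul hg))))
  refine hcd.congr fun x hx => ?_
  rw [← hS x hx, ← hC x hx]
  field_simp
  linear_combination (-φ x) * hSC x

/-- The invariance equation with `t ≠ s` forces the solution form. -/
lemma exists_solutionForm {I : Set ℝ} (hI : IsOpen I) (hI' : I.OrdConnected) (hne : I.Nonempty)
    {f g h k : ℝ → ℝ} {t s : ℝ} (hfg : regClass I 4 f g) (hhk : regClass I 4 h k)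
    (ht : 0 < t) (hs : 0 < s) (hts : t ≠ s) (hinv : invarianceEq I f g h k t s) :
    ∃ (p : ℝ) (φ : ℝ → ℝ), ContDiffOn ℝ 4 φ I ∧ (∀ x ∈ I, 0 < φ x) ∧
      solutionForm I p φ f g h k := by
  obtain ⟨σ₁, φ₁, z₁, w₁, z₁', w₁', P, P', hσ₁, hφ₁, hφ₁c, hf, hg, h₁, hP⟩ :=
    exists_isSolutionPair hI hI' hfg
  obtain ⟨σ₂, φ₂, z₂, w₂, z₂', w₂', Q, Q', hσ₂, hφ₂, hφ₂c, hh, hk, h₂, hQ⟩ :=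
    exists_isSolutionPair hI hI' hhk
  have hasymp := fun x₀ (hx₀ : x₀ ∈ I) =>
    exists_diagonal_asymptotics (φ₂ := φ₂) hI ht hs hx₀ h₁ h₂ (hP x₀ hx₀) (hQ x₀ hx₀) rfl rfl
      (hφ₁ x₀ hx₀) (hφ₁c.continuousAt (hI.mem_nhds hx₀)) fun y hy hxy =>
      hinv.exists_fundSol_eq hI' (regClass_four_subset_zero hI hI' hfg)
        (regClass_four_subset_zero hI hI' hhk) ht hs hσ₁ hσ₂ hφ₁ hφ₂ hf hg hh hk hx₀ hy hxy
  have hMc : ContinuousOn (fun x => φ₁ x * φ₂ x) I := hφ₁c.mul hφ₂c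
  have hM : ∀ x ∈ I, ∀ y ∈ I, φ₁ x * φ₂ x = φ₁ y * φ₂ y := by
    intro x hx y hy
    refine eq_of_right_deriv_zero (M := fun x => φ₁ x * φ₂ x) hI' hMc (fun a ha => ?_) hx hy
    obtain ⟨α, β, Ax, Bx, Ay, By, hα, hβ, hAx, hBx, hAy, hBy, hE⟩ := hasymp a ha
    exact hasDerivWithinAt_zero_of_asymptotics (hMc.continuousAt (hI.mem_nhds ha)) hα hβ
      (tendsto_of_tendsto_sub_div hAx) (tendsto_of_tendsto_sub_div hBx)
      (tendsto_of_tendsto_sub_div hAy) (tendsto_of_tendsto_sub_div hBy) hE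
  have hcoeff : ∀ x ∈ I, P x = Q x ∧
      (t / (t + s)) ^ 2 * (P' x / 6 * ((1 + s / (t + s)) / 2) - Q' x / 6 * (t / (t + s) / 2)) +
      (s / (t + s)) ^ 2 * (Q' x / 6 * ((1 + t / (t + s)) / 2) - P' x / 6 * (s / (t + s) / 2))
        = 0 := by
    intro x hx
    obtain ⟨α, β, Ax, Bx, Ay, By, hα, hβ, hAx, hBx, hAy, hBy, hE⟩ := hasymp x hx
    refine coeff_eq_of_asymptotics hα hβ ?_ hAx hBx hAy hBy ?_
    · rw [div_pow, div_pow]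
      intro e
      have e2 := (div_left_inj' (by positivity)).1 e
      exact hts ((pow_left_inj₀ ht.le hs.le two_ne_zero).1 e2)
    · have hxρ : Tendsto (fun ρ : ℝ => x + ρ) (𝓝[>] 0) (𝓝 x) := by
        have : Tendsto (fun ρ : ℝ => ρ) (𝓝[>] 0) (𝓝 0) :=
          tendsto_id.mono_left nhdsWithin_le_nhds
        simpa using this.const_add x
      filter_upwards [hE, hxρ.eventually_mem (hI.mem_nhds hx)] with ρ e hy
      rw [← hM x hx _ hy] at e
      exact mul_left_cancel₀ (mul_pos (hφ₁ x hx) (hφ₂ x hx)).ne' e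
  have hP0 : ∀ x ∈ I, HasDerivAt P 0 x := by
    intro x hx
    have hPQ : P' x = Q' x := (hP x hx).unique ((hQ x hx).congr_of_eventuallyEq
      (Filter.eventually_of_mem (hI.mem_nhds hx) fun y hy => (hcoeff y hy).1))
    have e := (hcoeff x hx).2
    rw [← hPQ] at e
    have hpos : 0 < t + s := by linarith
    -- both coefficients reduce to a positive multiple of `P' x`
    have e2 : t * s * (t + s) * P' x = 0 := by
      field_simp at e
      linear_combination e / 2
    have e3 : P' x = 0 := (mul_eq_zero.1 e2).resolve_left (by positivity)
    exact (hP x hx).congr_deriv e3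
  obtain ⟨x₀, hx₀⟩ := hne
  have hPp : ∀ x ∈ I, P x = P x₀ := fun x hx => eq_of_hasDerivAt_zero hI' hP0 hx hx₀
  have hQp : ∀ x ∈ I, Q x = P x₀ := fun x hx => (hcoeff x hx).1 ▸ hPp x hx
  have E₁ := h₁.pairEquiv_sineType_mul hI' ⟨x₀, hx₀⟩ hPp hσ₁ hf hg
  obtain ⟨a, b, c, d, hdet, hS, hC⟩ := h₂.pairEquiv_sineType_mul hI' ⟨x₀, hx₀⟩ hQp hσ₂ hh hk
  have hm : 0 < φ₁ x₀ * φ₂ x₀ := mul_pos (hφ₁ x₀ hx₀) (hφ₂ x₀ hx₀)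
  refine ⟨P x₀, fun x => (φ₁ x)⁻¹, (contDiffOn_of_pairEquiv hfg.1 hfg.2.1 E₁).inv
    fun x hx => (hφ₁ x hx).ne', fun x hx => inv_pos.2 (hφ₁ x hx), ?_, ?_⟩
  · simpa only [div_inv_eq_mul] using E₁
  · -- `φ₂` is the constant `φ₁(x₀) φ₂(x₀)` times `1 / φ₁`
    have hinv' : ∀ x ∈ I, (φ₁ x)⁻¹ = φ₂ x / (φ₁ x₀ * φ₂ x₀) := by
      intro x hx
      have := hφ₁ x hx
      rw [← hM x hx x₀ hx₀]
      have := hφ₂ x hx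
      field_simp
    generalize φ₁ x₀ * φ₂ x₀ = m at *
    refine ⟨a / m, b / m, c / m, d / m, fun e => hdet ?_, fun x hx => ?_, fun x hx => ?_⟩
    · field_simp at e
      exact e
    · have := hS x hx
      simp only at this ⊢
      rw [hinv' x hx, mul_div_assoc', this]
      ring
    · have := hC x hx
      simp only at this ⊢
      rw [hinv' x hx, mul_div_assoc', this]
      ring

end Bajraktarevic

theorem mainTheorem1 (I : Set ℝ) (hI_open : IsOpen I) (hI_interval : I.OrdConnected)
    (hI_nonempty : I.Nonempty) :
    (∀ (p : ℝ) (φ f g h k : ℝ → ℝ),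
      ContinuousOn φ I → (∀ x ∈ I, 0 < φ x) →
      Bajraktarevic.regClass I 0 f g → Bajraktarevic.regClass I 0 h k →
      Bajraktarevic.solutionForm I p φ f g h k →
      ∀ t s : ℝ, 0 < t → 0 < s → Bajraktarevic.invarianceEq I f g h k t s) ∧
    (∀ (f g h k : ℝ → ℝ) (t s : ℝ),
      Bajraktarevic.regClass I 4 f g → Bajraktarevic.regClass I 4 h k →
      0 < t → 0 < s → t ≠ s →
      Bajraktarevic.invarianceEq I f g h k t s →
      ∃ (p : ℝ) (φ : ℝ → ℝ), ContDiffOn ℝ 4 φ I ∧ (∀ x ∈ I, 0 < φ x) ∧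
        Bajraktarevic.solutionForm I p φ f g h k) :=
  ⟨fun _ _ _ _ _ _ _ hφ hfg hhk hsol _ _ ht hs =>
    Bajraktarevic.invarianceEq_of_solutionForm hI_interval hφ hfg hhk hsol ht hs,
  fun _ _ _ _ _ _ hfg hhk ht hs hts hinv =>
    Bajraktarevic.exists_solutionForm hI_open hI_interval hI_nonempty hfg hhk ht hs hts hinv⟩
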